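/- **Theorem 5.9 (generators).** Let $K$ be an algebraically closed field and let $P_1,\dots,P_r$ and $Q_1,\dots,Q_s$ ($r,s\ge 1$) be points of $\mathbb P^2_K$ with all coordinates nonzero, the $P_i$ lying on a line $\ell_P$ and the $Q_j$ on a line $\ell_Q$. Let $\star$ denote the coordinatewise (Hadamard) product of points, and write $\ell\star P=\{X\star P: X\in\ell\}$, which is again a line, for a line $\ell$ and a point $P$ with nonzero coordinates. Assume that the $rs$ points $P_i\star Q_j$ are pairwise distinct and that they form a grid, i.e. $\ell_Q\star P_i\ne \ell_P\star Q_j$ for all $i,j$. Let $1\le m_1\le\dots\le m_r$ and $1\le n_1\le\dots\le n_s$ be integers, and let $$\mathcal I(P_M,Q_N)=\bigcap_{i=1}^r\bigcap_{j=1}^s I(P_i\star Q_j)^{m_i+n_j-1}\subset K[x_0,x_1,x_2],$$ where $I(P)$ is the ideal generated by the homogeneous polynomials vanishing at $P$. Let $H_i$ be a linear form defining the line $\ell_Q\star P_{r-i+1}$ and $V_j$ a linear form defining the line $\ell_P\star Q_{s-j+1}$, and put $a_i=m_{r-i+1}+n_s-1$ and $b_j=n_{s-j+1}-n_s$. Then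 the $m_r+n_s$ products $$g_k=H_1^{a_1-k}\cdots H_r^{a_r-k}\cdot V_1^{b_1+k}\cdots V_s^{b_s+k},\qquad k=0,\dots,m_r+n_s-1,$$ in which every factor with exponent $\le 0$ is read as $1$, are pairwise distinct and form a minimal set of generators of $\mathcal I(P_M,Q_N)$: they generate the ideal and no proper subset of them does. If $K$ has characteristic $0$, the same set is also a minimal set of generators of the Hadamard product $I(P_M)\star I(Q_N)$ of the ideals $I(P_M)=\bigcap_i I(P_i)^{m_i}$ and $I(Q_N)=\bigcap_j I(Q_j)^{n_j}$, where $I\star J=\bigl(I(\mathbf y)+J(\mathbf z)+\langle x_c-y_cz_c\mid c=0,1,2\rangle\bigr)\cap K[\mathbf x]$. -/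

import Mathlib

open scoped LinearAlgebra.Projectivization

namespace HadamardGrid

/-- The projective plane over `K`; a point has homogeneous coordinates `p.rep 0, p.rep 1, p.rep 2`,
determined up to a common nonzero factor. -/
abbrev Plane (K : Type*) [Field K] : Type _ := ℙ K (Fin 3 → K)

/-- The polynomial ring `K[x₀, x₁, x₂]`. -/
abbrev Poly (K : Type*) [Field K] : Type _ := MvPolynomial (Fin 3) K

/-- `p` lies outside the three coordinate lines, that is, all its coordinates are nonzero. -/
def OffCoordinateLines {K : Type*} [Field K] (p : Plane K) : Prop :=
  ∀ c, p.rep c ≠ 0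

theorem OffCoordinateLines.mul_rep_ne_zero {K : Type*} [Field K] {p q : Plane K}
    (hp : OffCoordinateLines p) (hq : OffCoordinateLines q) : p.rep * q.rep ≠ 0 :=
  fun h => mul_ne_zero (hp 0) (hq 0) (congrFun h 0)

/-- The Hadamard product `p ⋆ q = [p₀q₀ : p₁q₁ : p₂q₂]` of two points, defined as soon as
some `pᵢqᵢ` is nonzero. -/
noncomputable def pointMul {K : Type*} [Field K] (p q : Plane K) (h : p.rep * q.rep ≠ 0) :
    Plane K :=
  Projectivization.mk K (p.rep * q.rep) h

/-- The set of all defined Hadamard products `p ⋆ q` with `p ∈ X`, `q ∈ Y`. When `X` is a line and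
`Y` is a point outside the coordinate lines (the only case used) this set is again a line, so no
Zariski closure has to be taken. -/
def setMul {K : Type*} [Field K] (X Y : Set (Plane K)) : Set (Plane K) :=
  {x | ∃ p ∈ X, ∃ q ∈ Y, ∃ h : p.rep * q.rep ≠ 0, x = pointMul p q h}

/-- The zero set in the projective plane of a homogeneous polynomial. -/
def zeroSet {K : Type*} [Field K] (f : Poly K) : Set (Plane K) :=
  {p | MvPolynomial.eval p.rep f = 0}

/-- A line of the projective plane: the zero set of a nonzero linear form. -/
def IsLine {K : Type*} [Field K] (l : Set (Plane K)) : Prop :=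
  ∃ f : Poly K, f ≠ 0 ∧ f.IsHomogeneous 1 ∧ l = zeroSet f

/-- `f` is a linear form that defines the line `l`. -/
def DefinesLine {K : Type*} [Field K] (f : Poly K) (l : Set (Plane K)) : Prop :=
  f ≠ 0 ∧ f.IsHomogeneous 1 ∧ zeroSet f = l

/-- The ideal `I(p)` generated by all homogeneous polynomials that vanish at `p`. -/
noncomputable def pointIdeal {K : Type*} [Field K] (p : Plane K) : Ideal (Poly K) :=
  Ideal.span {f | (∃ d : ℕ, f.IsHomogeneous d) ∧ MvPolynomial.eval p.rep f = 0}

/-- The ideal `⋂ᵢ I(Pᵢ)^(mᵢ)` of a set of fat points. -/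
noncomputable def fatIdeal {K : Type*} [Field K] {ι : Type*} (P : ι → Plane K) (m : ι → ℕ) :
    Ideal (Poly K) :=
  ⨅ i, pointIdeal (P i) ^ m i

/-- The Hadamard product `I ⋆ J` of two ideals of `K[x₀, x₁, x₂]`: the elimination ideal
`(I(y) + J(z) + ⟨xᵢ - yᵢzᵢ⟩) ∩ K[x]`. In `K[x, y, z]` the variables `x`, `y`, `z` are
indexed by the first, second and third summand of `Fin 3 ⊕ Fin 3 ⊕ Fin 3`. -/
noncomputable def idealMul {K : Type*} [Field K] (I J : Ideal (Poly K)) : Ideal (Poly K) :=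
  Ideal.comap (MvPolynomial.rename (R := K) (Sum.inl : Fin 3 → Fin 3 ⊕ Fin 3 ⊕ Fin 3))
    (Ideal.map (MvPolynomial.rename (R := K)
        (fun i : Fin 3 => (Sum.inr (Sum.inl i) : Fin 3 ⊕ Fin 3 ⊕ Fin 3))) I ⊔
      Ideal.map (MvPolynomial.rename (R := K)
        (fun i : Fin 3 => (Sum.inr (Sum.inr i) : Fin 3 ⊕ Fin 3 ⊕ Fin 3))) J ⊔
      Ideal.span (Set.range fun i : Fin 3 =>
        (MvPolynomial.X (Sum.inl i) -
          MvPolynomial.X (Sum.inr (Sum.inl i)) * MvPolynomial.X (Sum.inr (Sum.inr i)) :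
            MvPolynomial (Fin 3 ⊕ Fin 3 ⊕ Fin 3) K)))

/-- `G` is a minimal set of generators of `I`: it generates `I` and no proper subset does. -/
def IsMinimalGeneratingSet {K : Type*} [Field K] (I : Ideal (Poly K)) (G : Set (Poly K)) : Prop :=
  Minimal (fun S => Ideal.span S = I) G

/-- The product `∏ᵢ Hᵢ^(aᵢ - k) · ∏ⱼ Vⱼ^(bⱼ + k)`, where factors with an exponent `≤ 0` are `1`. -/
noncomputable def gridProduct {K : Type*} [Field K] {r s : ℕ} (H : Fin r → Poly K)
    (V : Fin s → Poly K) (a : Fin r → ℤ) (b : Fin s → ℤ) (k : ℕ) : Poly K :=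
  (∏ i, H i ^ (a i - k).toNat) * ∏ j, V j ^ (b j + k).toNat

end HadamardGrid

namespace HadamardGrid

open MvPolynomial
open scoped LinearAlgebra.Projectivization

/-! Through the point where the grid lines `H i` and `V j` cross, these two distinct lines generate
the ideal `(H i, V j)`. With `c j = n_s - n_j` (indices reversed) its multiplicity is `a i - c j`,
so the fat point ideal is `⨅ (H i, V j) ^ (a i - c j)`.

Generation (`mem_span_gridProducts`): choose `j` with `c j` minimal. On the line `V j = 0`, an
element `f` of the ideal has prescribed zeros, hence is a multiple of `∏ H i ^ (a i - c j)`; this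
product is itself the generator with `t = c j`. Subtracting the multiple leaves `V j * f'`, where
`f'` satisfies the same conditions with `c j` raised by one, so induction applies. Cancelling `V j`
needs point ideals to have primary powers and linear forms to vanish to order at most one; both
follow from the deformation `tangentHom`, which turns order of vanishing into divisibility by a
power of `T`.

Minimality (`notMem_span_of_exponents`): at the point of largest multiplicity the two lines `h`, `v`
occur in `g k` with exponents `N - k` and `k`, where `N = m_r + n_s - 1`, and the cofactor does not
vanish there. No combination of the other products can produce this.

Hadamard product (`idealMul_fatIdeal`): elimination makes `I ⋆ J` the preimage of `I ⊗ B + A ⊗ J`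
under `x_c ↦ x_c ⊗ x_c`. Such sums commute with finite intersections over a field, which reduces to
two points; there the operators `x_c ∂_c` and characteristic zero give the exponent `m + n - 1`. -/

variable {K : Type*} [Field K]

/-! ### Point ideals and order of vanishing -/

/-- Restriction of polynomials to the line through the origin spanned by `v`. -/
noncomputable def coneHom (v : Fin 3 → K) : Poly K →ₐ[K] Polynomial K :=
  aeval fun c => Polynomial.C (v c) * Polynomial.X

/-- The ideal of the line through the origin spanned by `v`. -/
noncomputable def coneIdeal (v : Fin 3 → K) : Ideal (Poly K) := RingHom.ker (coneHom v)

/-- The linear form `x_c - (v_c / v_0) x_0`, which vanishes at `v`. -/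
noncomputable def localParam (v : Fin 3 → K) (c : Fin 3) : Poly K := X c - C (v c / v 0) * X 0

/-- The deformation to the tangent cone at `v`: the parameters `localParam v c` are multiplied
by `T`, and `x_0` is fixed. -/
noncomputable def tangentHom (v : Fin 3 → K) : Poly K →ₐ[K] Polynomial (Poly K) :=
  aeval fun c => Polynomial.C (localParam v c) * Polynomial.X +
    Polynomial.C (C (v c / v 0) * X 0)

theorem coneHom_of_isHomogeneous (v : Fin 3 → K) {f : Poly K} {d : ℕ} (hf : f.IsHomogeneous d) :
    coneHom v f = Polynomial.C (eval v f) * Polynomial.X ^ d := by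
  rw [coneHom, aeval_def, eval₂_eq', eval_eq', map_sum, Finset.sum_mul]
  refine Finset.sum_congr rfl fun m hm => ?_
  have hd : ∑ c, m c = d := by
    have := hf (mem_support_iff.mp hm)
    simpa [Finsupp.weight_apply, Finsupp.sum_fintype] using this
  simp only [mul_pow, Finset.prod_mul_distrib, Finset.prod_pow_eq_pow_sum, hd, map_mul, map_prod,
    map_pow, mul_assoc, Polynomial.algebraMap_eq]

theorem mem_coneIdeal_of_isHomogeneous (v : Fin 3 → K) {f : Poly K} {d : ℕ}
    (hf : f.IsHomogeneous d) : f ∈ coneIdeal v ↔ eval v f = 0 := by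
  rw [coneIdeal, RingHom.mem_ker, coneHom_of_isHomogeneous v hf]
  simp

instance coneIdeal_isPrime (v : Fin 3 → K) : (coneIdeal v).IsPrime := RingHom.ker_isPrime _

theorem localParam_isHomogeneous (v : Fin 3 → K) (c : Fin 3) :
    (localParam v c).IsHomogeneous 1 :=
  (isHomogeneous_X K c).sub (isHomogeneous_C_mul_X _ _)

theorem eval_localParam {v : Fin 3 → K} (hv : v 0 ≠ 0) (c : Fin 3) :
    eval v (localParam v c) = 0 := by
  simp [localParam, hv]

/-- Modulo the forms `localParam v c` every variable is a multiple of `x_0`, so the quotient map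
factors through `coneHom v` and kills its kernel. -/
theorem coneIdeal_eq_span {v : Fin 3 → K} (hv : v 0 ≠ 0) :
    coneIdeal v = Ideal.span (Set.range (localParam v)) := by
  apply le_antisymm
  · intro f hf
    set J := Ideal.span (Set.range (localParam v))
    let σ : Polynomial K →ₐ[K] Poly K := Polynomial.aeval (C (v 0)⁻¹ * X 0)
    have h : (Ideal.Quotient.mkₐ K J).comp (σ.comp (coneHom v)) = Ideal.Quotient.mkₐ K J := by
      ext c
      simp only [AlgHom.comp_apply, coneHom, aeval_X, Ideal.Quotient.mkₐ_eq_mk]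
      rw [eq_comm, Ideal.Quotient.eq]
      have : σ (Polynomial.C (v c) * Polynomial.X) = C (v c / v 0) * X 0 := by
        simp [σ, div_eq_mul_inv, MvPolynomial.algebraMap_eq, mul_assoc]
      rw [this]
      exact Ideal.subset_span ⟨c, rfl⟩
    have h2 := DFunLike.congr_fun h f
    rw [coneIdeal, RingHom.mem_ker] at hf
    simp only [AlgHom.comp_apply, hf, map_zero, Ideal.Quotient.mkₐ_eq_mk] at h2
    exact Ideal.Quotient.eq_zero_iff_mem.mp h2.symm
  · rw [Ideal.span_le]
    rintro _ ⟨c, rfl⟩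
    exact (mem_coneIdeal_of_isHomogeneous v (localParam_isHomogeneous v c)).2
      (eval_localParam hv c)

theorem coneIdeal_smul {v : Fin 3 → K} (hv : v 0 ≠ 0) {k : K} (hk : k ≠ 0) :
    coneIdeal (k • v) = coneIdeal v := by
  rw [coneIdeal_eq_span hv, coneIdeal_eq_span (by simp [hk, hv])]
  have : localParam (k • v) = localParam v := by
    ext1 c
    simp [localParam, mul_div_mul_left _ _ hk]
  rw [this]

theorem pointIdeal_eq_coneIdeal {p : Plane K} (hp : p.rep 0 ≠ 0) :
    pointIdeal p = coneIdeal p.rep := by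
  apply le_antisymm
  · rw [pointIdeal, Ideal.span_le]
    rintro f ⟨⟨d, hd⟩, hf⟩
    exact (mem_coneIdeal_of_isHomogeneous _ hd).2 hf
  · rw [coneIdeal_eq_span hp, Ideal.span_le]
    rintro _ ⟨c, rfl⟩
    exact Ideal.subset_span ⟨⟨1, localParam_isHomogeneous _ c⟩, eval_localParam hp c⟩

theorem tangentHom_localParam {v : Fin 3 → K} (hv : v 0 ≠ 0) (c : Fin 3) :
    tangentHom v (localParam v c) = Polynomial.C (localParam v c) * Polynomial.X := by
  have h0 : localParam v 0 = 0 := by simp [localParam, hv]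
  conv_lhs => rw [localParam]
  rw [map_sub, map_mul, ← MvPolynomial.algebraMap_eq, AlgHom.commutes]
  simp only [tangentHom, aeval_X, h0]
  rw [Polynomial.algebraMap_apply, MvPolynomial.algebraMap_eq]
  simp [hv]

theorem evalRingHom_one_tangentHom (v : Fin 3 → K) (f : Poly K) :
    (tangentHom v f).eval 1 = f := by
  have : ((Polynomial.aeval (1 : Poly K)).restrictScalars K).comp (tangentHom v) =
      AlgHom.id K (Poly K) := by
    ext c
    simp [tangentHom, localParam]
  simpa [Polynomial.aeval_def] using DFunLike.congr_fun this f

/-- The coefficient of `T ^ i` lies in the `i`-th power of the point ideal; it suffices to check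
this on the variables. -/
theorem tangentHom_mem_reesAlgebra {v : Fin 3 → K} (hv : v 0 ≠ 0) (f : Poly K) :
    tangentHom v f ∈ reesAlgebra (coneIdeal v) := by
  induction f using MvPolynomial.induction_on with
  | C a =>
    rw [← MvPolynomial.algebraMap_eq, AlgHom.commutes, Polynomial.algebraMap_apply]
    exact Subalgebra.algebraMap_mem _ _
  | add p q hp hq => rw [map_add]; exact add_mem hp hq
  | mul_X p c hp =>
    rw [map_mul]
    refine mul_mem hp ?_
    simp only [tangentHom, aeval_X]
    refine add_mem ?_ (Subalgebra.algebraMap_mem _ _)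
    rw [Polynomial.C_mul_X_eq_monomial]
    refine reesAlgebra.monomial_mem.2 ?_
    rw [pow_one, coneIdeal_eq_span hv]
    exact Ideal.subset_span ⟨c, rfl⟩

/-- Generators of the ideal acquire a factor `T`. Conversely, setting `T = 1` writes `f` as the sum
of its coefficients, the `i`-th of which lies in the `i`-th power. -/
theorem mem_coneIdeal_pow_iff {v : Fin 3 → K} (hv : v 0 ≠ 0) (f : Poly K) (e : ℕ) :
    f ∈ coneIdeal v ^ e ↔ Polynomial.X ^ e ∣ tangentHom v f := by
  constructor
  · intro hf
    have h1 : (coneIdeal v).map (tangentHom v) ≤ Ideal.span {Polynomial.X} := by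
      rw [coneIdeal_eq_span hv, Ideal.map_span, Ideal.span_le]
      rintro _ ⟨_, ⟨c, rfl⟩, rfl⟩
      rw [tangentHom_localParam hv]
      exact Ideal.mem_span_singleton.2 (dvd_mul_left _ _)
    have h2 := Ideal.pow_right_mono h1 e
    rw [← Ideal.map_pow, Ideal.span_singleton_pow] at h2
    exact Ideal.mem_span_singleton.1 (h2 (Ideal.mem_map_of_mem _ hf))
  · intro h
    have hR := tangentHom_mem_reesAlgebra hv f
    rw [Polynomial.X_pow_dvd_iff] at h
    rw [← evalRingHom_one_tangentHom v f, Polynomial.eval_eq_sum_range]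
    refine Ideal.sum_mem _ fun i _ => ?_
    rw [one_pow, mul_one]
    rcases lt_or_ge i e with hi | hi
    · rw [h i hi]; exact zero_mem _
    · exact Ideal.pow_le_pow_right hi (hR i)

/-- Powers of a point ideal are primary, because `T` is prime in `K[x][T]`. -/
theorem mem_coneIdeal_pow_of_mul_mem {v : Fin 3 → K} (hv : v 0 ≠ 0) {f g : Poly K} {e : ℕ}
    (hg : g ∉ coneIdeal v) (h : g * f ∈ coneIdeal v ^ e) : f ∈ coneIdeal v ^ e := by
  rw [mem_coneIdeal_pow_iff hv] at h ⊢
  rw [map_mul] at h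
  refine Polynomial.prime_X.pow_dvd_of_dvd_mul_left e (fun hX => hg ?_) h
  have := (mem_coneIdeal_pow_iff hv g 1).2 (by rwa [pow_one])
  rwa [pow_one] at this

theorem notMem_coneIdeal_sq {v : Fin 3 → K} (hv : v 0 ≠ 0) {g : Poly K} (hg0 : g ≠ 0)
    (hg : g.IsHomogeneous 1) : g ∉ coneIdeal v ^ 2 := by
  intro h
  rw [mem_coneIdeal_pow_iff hv] at h
  have hdeg : (tangentHom v g).natDegree ≤ 1 := by
    have : g ∈ homogeneousSubmodule (Fin 3) K 1 := hg
    rw [homogeneousSubmodule_one_eq_span_X] at this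
    refine Submodule.span_induction (p := fun x _ => (tangentHom v x).natDegree ≤ 1) ?_ ?_ ?_ ?_
      this
    · rintro _ ⟨c, rfl⟩
      simp only [tangentHom, aeval_X]
      exact Polynomial.natDegree_linear_le
    · simp
    · intro x y _ _ hx hy
      rw [map_add]
      exact Polynomial.natDegree_add_le_of_degree_le hx hy
    · intro a x _ hx
      rw [map_smul]
      exact (Polynomial.natDegree_smul_le _ _).trans hx
  have h0 : tangentHom v g = 0 := by
    by_contra hne
    have := Polynomial.natDegree_le_of_dvd h hne
    rw [Polynomial.natDegree_X_pow] at this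
    omega
  exact hg0 (by rw [← evalRingHom_one_tangentHom v g, h0, Polynomial.eval_zero])

theorem mem_coneIdeal_pow_of_linear_mul_mem {v : Fin 3 → K} (hv : v 0 ≠ 0) {f g : Poly K} {e : ℕ}
    (hg0 : g ≠ 0) (hg : g.IsHomogeneous 1) (h : g * f ∈ coneIdeal v ^ (e + 1)) :
    f ∈ coneIdeal v ^ e := by
  by_cases hgm : g ∈ coneIdeal v
  · rw [mem_coneIdeal_pow_iff hv] at h ⊢
    obtain ⟨w, hw⟩ : Polynomial.X ∣ tangentHom v g := by
      simpa using (mem_coneIdeal_pow_iff hv g 1).1 (by rwa [pow_one])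
    rw [map_mul, hw, pow_succ', mul_assoc] at h
    refine Polynomial.prime_X.pow_dvd_of_dvd_mul_left e (fun hX => ?_)
      ((mul_dvd_mul_iff_left Polynomial.X_ne_zero).1 h)
    refine notMem_coneIdeal_sq hv hg0 hg ?_
    rw [mem_coneIdeal_pow_iff hv, hw, pow_two]
    exact mul_dvd_mul_left _ hX
  · exact Ideal.pow_le_pow_right (Nat.le_succ e) (mem_coneIdeal_pow_of_mul_mem hv hgm h)

/-- In characteristic zero, the order of vanishing is detected by partial derivatives. -/
theorem mem_coneIdeal_pow_succ_of_pderiv [CharZero K] {v : Fin 3 → K} (hv : v 0 ≠ 0)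
    {f : Poly K} {e : ℕ} (hf : f ∈ coneIdeal v)
    (h : ∀ c, pderiv c f ∈ coneIdeal v ^ e) : f ∈ coneIdeal v ^ (e + 1) := by
  -- The chain rule for differentiation in `T`.
  have key : ∀ f : Poly K, Polynomial.derivative (tangentHom v f) =
      ∑ c, tangentHom v (pderiv c f) * Polynomial.C (localParam v c) := by
    intro f
    induction f using MvPolynomial.induction_on with
    | C a =>
      rw [← MvPolynomial.algebraMap_eq, AlgHom.commutes, Polynomial.algebraMap_apply]
      simp
    | add p q hp hq => simp [hp, hq, add_mul, Finset.sum_add_distrib]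
    | mul_X p i hp =>
      have hX : Polynomial.derivative (tangentHom v (X i)) =
          Polynomial.C (localParam v i) := by
        simp [tangentHom]
      have hT : ∀ c, tangentHom v (pderiv c (p * X i)) * Polynomial.C (localParam v c) =
          tangentHom v (pderiv c p) * Polynomial.C (localParam v c) * tangentHom v (X i) +
            (if c = i then tangentHom v p * Polynomial.C (localParam v c) else 0) := by
        intro c
        rw [pderiv_mul, map_add, map_mul, map_mul, pderiv_X]
        split_ifs with hc
        · subst hc
          rw [Pi.single_eq_same, map_one]
          ring
        · rw [Pi.single_eq_of_ne' hc, map_zero]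
          ring
      rw [map_mul, Polynomial.derivative_mul, hp, hX, Finset.sum_congr rfl fun c _ => hT c,
        Finset.sum_add_distrib, Finset.sum_mul]
      simp
  have hd : Polynomial.X ^ e ∣ Polynomial.derivative (tangentHom v f) := by
    rw [key]
    exact Finset.dvd_sum fun c _ => ((mem_coneIdeal_pow_iff hv _ e).1 (h c)).mul_right _
  rw [mem_coneIdeal_pow_iff hv, Polynomial.X_pow_dvd_iff]
  rw [Polynomial.X_pow_dvd_iff] at hd
  rintro (_ | d) hde
  · have := (mem_coneIdeal_pow_iff hv f 1).1 (by rwa [pow_one])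
    rw [pow_one, Polynomial.X_dvd_iff] at this
    exact this
  -- The derivative determines the coefficient of `T ^ (d + 1)` only up to the factor `d + 1`,
  -- invertible in characteristic zero.
  · have := hd d (by omega)
    rw [Polynomial.coeff_derivative] at this
    exact (mul_eq_zero.1 this).resolve_right (by exact_mod_cast Nat.succ_ne_zero d)

/-! ### Linear forms and lines -/

theorem exists_eq_sum_C_mul_X {f : Poly K} (hf : f.IsHomogeneous 1) :
    ∃ a : Fin 3 → K, f = ∑ c, C (a c) * X c := by
  have : f ∈ homogeneousSubmodule (Fin 3) K 1 := hf
  rw [homogeneousSubmodule_one_eq_span_X, Submodule.mem_span_range_iff_exists_fun] at this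
  obtain ⟨a, ha⟩ := this
  exact ⟨a, by simp_rw [← ha, smul_eq_C_mul]⟩

theorem linear_prime {f : Poly K} (h0 : f ≠ 0) (hf : f.IsHomogeneous 1) : Prime f := by
  refine Irreducible.prime (irreducible_of_totalDegree_eq_one (hf.totalDegree h0) ?_)
  intro x hx
  obtain ⟨m, hm⟩ := ne_zero_iff.1 h0
  exact isUnit_of_dvd_unit (hx m) (isUnit_iff_ne_zero.2 hm)

theorem zeroSet_eq_of_minors {f g : Poly K} (hf0 : f ≠ 0) (hg0 : g ≠ 0) {a b : Fin 3 → K}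
    (hf : f = ∑ c, C (a c) * X c) (hg : g = ∑ c, C (b c) * X c)
    (h : ∀ c d, a c * b d = a d * b c) : zeroSet f = zeroSet g := by
  obtain ⟨c, hc⟩ : ∃ c, a c ≠ 0 := by
    by_contra! hall
    exact hf0 (by simp [hf, hall])
  have key : C (a c) * g = C (b c) * f := by
    rw [hf, hg, Finset.mul_sum, Finset.mul_sum]
    refine Finset.sum_congr rfl fun d _ => ?_
    rw [← mul_assoc, ← mul_assoc, ← C_mul, ← C_mul, h c d, mul_comm (a d)]
  have hbc : b c ≠ 0 := by
    intro hb
    rw [hb, C_0, zero_mul] at key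
    exact hg0 ((mul_eq_zero.1 key).resolve_left (by simpa using hc))
  ext p
  have hp := congrArg (eval p.rep) key
  simp only [map_mul, eval_C] at hp
  simp only [zeroSet, Set.mem_ofPred_eq]
  constructor
  · intro h1
    rw [h1, mul_zero] at hp
    exact (mul_eq_zero.1 hp).resolve_left hc
  · intro h1
    rw [h1, mul_zero] at hp
    exact (mul_eq_zero.1 hp.symm).resolve_left hbc

/-- Two distinct lines through a point generate the ideal of that point. -/
theorem coneIdeal_le_span_pair {f g : Poly K} (hf0 : f ≠ 0) (hf : f.IsHomogeneous 1)
    (hg0 : g ≠ 0) (hg : g.IsHomogeneous 1) (hfg : zeroSet f ≠ zeroSet g) {v : Fin 3 → K}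
    (hv : v 0 ≠ 0) (hfv : eval v f = 0) (hgv : eval v g = 0) :
    coneIdeal v ≤ Ideal.span {f, g} := by
  obtain ⟨a, ha⟩ := exists_eq_sum_C_mul_X hf
  obtain ⟨b, hb⟩ := exists_eq_sum_C_mul_X hg
  have ha' : a 0 * v 0 + a 1 * v 1 + a 2 * v 2 = 0 := by
    simpa [ha, Fin.sum_univ_three] using hfv
  have hb' : b 0 * v 0 + b 1 * v 1 + b 2 * v 2 = 0 := by
    simpa [hb, Fin.sum_univ_three] using hgv
  -- `v` is proportional to the cross product of `a` and `b`, whose first entry is `D`. If `D = 0`,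
  -- then `v 0 ≠ 0` makes all minors vanish and the lines coincide.
  set D := a 1 * b 2 - a 2 * b 1 with hD
  have e1 : (a 2 * b 0 - a 0 * b 2) * v 0 = D * v 1 := by
    linear_combination (a 2) * hb' - b 2 * ha'
  have e2 : (a 0 * b 1 - a 1 * b 0) * v 0 = D * v 2 := by
    linear_combination b 1 * ha' - (a 1) * hb'
  have hD0 : D ≠ 0 := by
    intro h0
    rw [h0, zero_mul] at e1 e2
    have e1' := (mul_eq_zero.1 e1).resolve_right hv
    have e2' := (mul_eq_zero.1 e2).resolve_right hv
    refine hfg (zeroSet_eq_of_minors hf0 hg0 ha hb fun c d => ?_)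
    rw [hD] at h0
    fin_cases c <;> fin_cases d <;> dsimp <;>
      first
      | ring1
      | linear_combination h0
      | linear_combination -h0
      | linear_combination e1'
      | linear_combination -e1'
      | linear_combination e2'
      | linear_combination -e2'
  have r1 : v 1 / v 0 = (a 2 * b 0 - a 0 * b 2) / D := by
    rw [div_eq_div_iff hv hD0]; linear_combination -e1
  have r2 : v 2 / v 0 = (a 0 * b 1 - a 1 * b 0) / D := by
    rw [div_eq_div_iff hv hD0]; linear_combination -e2
  have hCD : C D * C D⁻¹ = (1 : Poly K) := by rw [← C_mul, mul_inv_cancel₀ hD0, C_1]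
  rw [coneIdeal_eq_span hv, Ideal.span_le]
  rintro _ ⟨c, rfl⟩
  rw [SetLike.mem_coe, Ideal.mem_span_pair]
  fin_cases c
  · exact ⟨0, 0, by simp [localParam, hv]⟩
  -- Eliminating `x_2` between the two forms gives `D` times the parameter; the next case eliminates
  -- `x_1`.
  · refine ⟨C (b 2) * C D⁻¹, -C (a 2) * C D⁻¹, ?_⟩
    simp only [localParam, Fin.mk_one, r1, ha, hb, Fin.sum_univ_three, div_eq_mul_inv, C_mul]
    simp only [hD, map_sub, map_mul] at hCD ⊢
    linear_combination (X 1) * hCD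
  · refine ⟨-C (b 1) * C D⁻¹, C (a 1) * C D⁻¹, ?_⟩
    simp only [localParam, Fin.reduceFinMk, r2, ha, hb, Fin.sum_univ_three, div_eq_mul_inv, C_mul]
    simp only [hD, map_sub, map_mul] at hCD ⊢
    linear_combination (X 2) * hCD

/-! ### Generators of a grid of fat points over a commutative ring -/

section Generators

variable {R ι κ : Type*} [CommRing R]

/-- If `∏ₗ hₗ^(eₗ)` is a product of powers of pairwise non-associated primes, it divides every
common multiple of its factors. -/
theorem prod_prime_pow_dvd [IsDomain R] {s : Finset ι} {h : ι → R} {e : ι → ℕ} {f : R}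
    (hp : ∀ i ∈ s, Prime (h i)) (hne : ∀ i ∈ s, ∀ i' ∈ s, i ≠ i' → ¬ h i ∣ h i')
    (hf : ∀ i ∈ s, h i ^ e i ∣ f) : ∏ i ∈ s, h i ^ e i ∣ f := by
  classical
  induction s using Finset.induction_on generalizing f with
  | empty => simp
  | insert i s hi ih =>
    obtain ⟨u, rfl⟩ := hf i (Finset.mem_insert_self _ _)
    rw [Finset.prod_insert hi]
    refine mul_dvd_mul_left _ (ih (fun k hk => hp k (Finset.mem_insert_of_mem hk))
      (fun k hk k' hk' => hne k (Finset.mem_insert_of_mem hk) k' (Finset.mem_insert_of_mem hk'))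
      fun k hk => ?_)
    have hki : k ≠ i := by rintro rfl; exact hi hk
    have hpk := hp k (Finset.mem_insert_of_mem hk)
    refine hpk.pow_dvd_of_dvd_mul_left _ (fun hd => ?_) (hf k (Finset.mem_insert_of_mem hk))
    exact hne k (Finset.mem_insert_of_mem hk) i (Finset.mem_insert_self _ _) hki
      (hpk.dvd_of_dvd_pow hd)

variable [Fintype ι] [Fintype κ]

/-- On the line `V`, a function vanishing to order `e i` at the point cut out by `H i`
is a multiple of `∏ᵢ Hᵢ^(eᵢ)`. -/
theorem mem_span_line_sup {H : ι → R} {V : R} {I : ι → Ideal R} (hV : Prime V)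
    (hI : ∀ i, I i = Ideal.span {H i, V}) (hprime : ∀ i, (I i).IsPrime)
    (hVH : ∀ i, ¬ V ∣ H i) (hne : ∀ i i', i ≠ i' → H i ∉ I i') {e : ι → ℕ} {f : R}
    (hf : ∀ i, f ∈ I i ^ e i) : ∃ u, V ∣ f - u * ∏ i, H i ^ e i := by
  -- In the domain `R / (V)` each `I i` becomes the principal prime ideal `(H i)`, so divisibility
  -- by prime powers applies.
  let J : Ideal R := Ideal.span {V}
  have hJ : J.IsPrime := (Ideal.span_singleton_prime hV.ne_zero).2 hV
  let π := Ideal.Quotient.mk J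
  have hπV : π V = 0 := Ideal.Quotient.eq_zero_iff_mem.2 (Ideal.mem_span_singleton_self V)
  have hmap : ∀ i, (I i).map π = Ideal.span {π (H i)} := by
    intro i
    rw [hI, Ideal.map_span, Set.image_pair, hπV, Ideal.span_pair_zero]
  have hπH : ∀ i, π (H i) ≠ 0 := fun i h =>
    hVH i (Ideal.mem_span_singleton.1 (Ideal.Quotient.eq_zero_iff_mem.1 h))
  have hJI : ∀ i, J ≤ I i := by
    intro i
    rw [hI]
    exact Ideal.span_mono (by simp)
  have hdvd : ∏ i, π (H i) ^ e i ∣ π f := by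
    refine prod_prime_pow_dvd (fun i _ => ?_) (fun i _ i' _ hii' hd => ?_) fun i _ => ?_
    · rw [← Ideal.span_singleton_prime (hπH i), ← hmap]
      have := hprime i
      exact Ideal.map_isPrime_of_surjective Ideal.Quotient.mk_surjective
        (by rw [Ideal.mk_ker]; exact hJI i)
    · refine hne i' i hii'.symm ?_
      rw [← Ideal.mem_span_singleton, ← hmap,
        Ideal.mem_map_iff_of_surjective _ Ideal.Quotient.mk_surjective] at hd
      obtain ⟨x, hx, hx'⟩ := hd
      have := hJI i (Ideal.Quotient.eq.1 hx')
      simpa using (I i).sub_mem hx this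
    · have := Ideal.mem_map_of_mem π (hf i)
      rwa [Ideal.map_pow, hmap, Ideal.span_singleton_pow, Ideal.mem_span_singleton] at this
  obtain ⟨w, hw⟩ := hdvd
  obtain ⟨u, rfl⟩ := Ideal.Quotient.mk_surjective w
  refine ⟨u, Ideal.mem_span_singleton.1 (Ideal.Quotient.eq.1 ?_)⟩
  rw [map_mul, map_prod, mul_comm]
  simpa using hw

/-- The intersection of the powers `(Hᵢ, Vⱼ)^(aᵢ - cⱼ)` of the ideals of the points of a grid is
generated by the products `∏ᵢ Hᵢ^(aᵢ - t) ∏ⱼ Vⱼ^(t - cⱼ)` (truncated subtraction). -/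
theorem mem_span_gridProducts [IsDomain R] {H : ι → R} {V : κ → R} {I : ι → κ → Ideal R}
    (hV : ∀ j, Prime (V j)) (hI : ∀ i j, I i j = Ideal.span {H i, V j})
    (hprime : ∀ i j, (I i j).IsPrime) (hVH : ∀ i j, ¬ V j ∣ H i)
    (hne : ∀ i i' j, i ≠ i' → H i ∉ I i' j)
    (hsame : ∀ i j e f, V j * f ∈ I i j ^ (e + 1) → f ∈ I i j ^ e)
    (hother : ∀ i j j' e f, j ≠ j' → V j * f ∈ I i j' ^ e → f ∈ I i j' ^ e)
    (a : ι → ℕ) (c : κ → ℕ) {f : R} (hf : ∀ i j, f ∈ I i j ^ (a i - c j)) :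
    f ∈ Ideal.span (Set.range fun t : ℕ => (∏ i, H i ^ (a i - t)) * ∏ j, V j ^ (t - c j)) := by
  classical
  obtain ⟨N, hN⟩ : ∃ N, ∀ i, a i ≤ N :=
    ⟨∑ i, a i, fun i => Finset.single_le_sum (fun _ _ => Nat.zero_le _) (Finset.mem_univ i)⟩
  -- Raising one `c j < N` lowers this sum. Once all `c j ≥ N`, the product with `t = N` is `1`.
  induction hD : ∑ j, (N - c j) using Nat.strong_induction_on generalizing c f with
  | _ D ih =>
  subst hD
  by_cases hc : ∀ j, N ≤ c j
  · have h1 : (∏ i, H i ^ (a i - N)) * ∏ j, V j ^ (N - c j) = 1 := by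
      rw [Finset.prod_eq_one fun i _ => by rw [Nat.sub_eq_zero_of_le (hN i), pow_zero],
        Finset.prod_eq_one fun j _ => by rw [Nat.sub_eq_zero_of_le (hc j), pow_zero], mul_one]
    rw [(Ideal.eq_top_iff_one _).2 (Ideal.subset_span (Set.mem_range.2 ⟨N, h1⟩))]
    trivial
  · push Not at hc
    obtain ⟨j₀, hj₀⟩ := hc
    obtain ⟨j, -, hj⟩ := Finset.exists_min_image Finset.univ c ⟨j₀, Finset.mem_univ _⟩
    have hjN : c j < N := (hj j₀ (Finset.mem_univ _)).trans_lt hj₀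
    obtain ⟨u, f', hf'⟩ := mem_span_line_sup (hV j) (fun i => hI i j) (fun i => hprime i j)
      (fun i => hVH i j) (fun i i' h => hne i i' j h) (fun i => hf i j)
    have hH : ∀ i j, H i ∈ I i j := fun i j => by
      rw [hI]; exact Ideal.subset_span (by simp)
    -- Minimality of `c j` puts the subtracted product in every `I i j' ^ (a i - c j')`.
    have hmem : ∀ i j', V j * f' ∈ I i j' ^ (a i - c j') := by
      intro i j'
      rw [← hf']
      refine sub_mem (hf i j') (Ideal.mul_mem_left _ _ ?_)
      refine Ideal.mem_of_dvd _ (Finset.dvd_prod_of_mem _ (Finset.mem_univ i)) ?_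
      exact Ideal.pow_le_pow_right (Nat.sub_le_sub_left (hj j' (Finset.mem_univ _)) _)
        (Ideal.pow_mem_pow (hH i j') _)
    have hg : ∏ i, H i ^ (a i - c j) ∈
        Ideal.span (Set.range fun t : ℕ => (∏ i, H i ^ (a i - t)) * ∏ j, V j ^ (t - c j)) := by
      refine Ideal.subset_span ⟨c j, ?_⟩
      dsimp only
      rw [Finset.prod_eq_one (f := fun j' => V j' ^ (c j - c j')) fun j' _ => by
        rw [Nat.sub_eq_zero_of_le (hj j' (Finset.mem_univ _)), pow_zero], mul_one]
    have hf2 := ih _ ?_ (Function.update c j (c j + 1)) (f := f') ?_ rfl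
    · rw [← sub_add_cancel f (u * ∏ i, H i ^ (a i - c j)), hf']
      refine add_mem ?_ (Ideal.mul_mem_left _ _ hg)
      have := Ideal.mul_mem_mul (Ideal.mem_span_singleton_self (V j)) hf2
      refine (show _ ≤ Ideal.span _ from ?_) this
      rw [Ideal.span_mul_span', Set.singleton_mul, Ideal.span_le]
      rintro _ ⟨_, ⟨t, rfl⟩, rfl⟩
      have hrest : ∏ j' ∈ Finset.univ.erase j, V j' ^ (t - Function.update c j (c j + 1) j') =
          ∏ j' ∈ Finset.univ.erase j, V j' ^ (t - c j') :=
        Finset.prod_congr rfl fun j' hj' => by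
          rw [Function.update_of_ne (Finset.ne_of_mem_erase hj')]
      have hG : (∏ i, H i ^ (a i - t)) * ∏ j, V j ^ (t - c j) ∈
        Ideal.span (Set.range fun t : ℕ => (∏ i, H i ^ (a i - t)) * ∏ j, V j ^ (t - c j)) :=
        Ideal.subset_span ⟨t, rfl⟩
      refine Ideal.mem_of_dvd _ ?_ hG
      dsimp only
      rw [mul_left_comm]
      refine mul_dvd_mul_left _ ?_
      rw [← Finset.mul_prod_erase _ _ (Finset.mem_univ j),
        ← Finset.mul_prod_erase _ (fun j' => V j' ^ (t - Function.update c j (c j + 1) j'))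
          (Finset.mem_univ j), hrest, Function.update_self, ← mul_assoc, ← pow_succ']
      -- Truncated subtraction gives only `t - c j ≤ (t - (c j + 1)) + 1`, hence divisibility rather
      -- than equality.
      exact mul_dvd_mul_right (pow_dvd_pow _ (by omega)) _
    · refine Finset.sum_lt_sum (fun j' _ => ?_) ⟨j, Finset.mem_univ _, ?_⟩
      · rcases eq_or_ne j' j with rfl | h
        · rw [Function.update_self]; omega
        · rw [Function.update_of_ne h]
      · rw [Function.update_self]; omega
    · intro i j'
      rcases eq_or_ne j' j with rfl | h
      · rw [Function.update_self]
        rcases Nat.eq_zero_or_pos (a i - c j') with h0 | h0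
        · rw [show a i - (c j' + 1) = 0 by omega, pow_zero, Ideal.one_eq_top]; trivial
        · refine hsame i j' _ _ ?_
          rw [show a i - (c j' + 1) + 1 = a i - c j' by omega]
          exact hmem i j'
      · rw [Function.update_of_ne h]
        exact hother i j j' _ _ h.symm (hmem i j')

/-- A product `h^(N-k) v^k q` is not generated by products `h^(N-l) v^l q'` with `l ≠ k`, when
`q` lies outside an ideal containing `h` and `v`. -/
theorem notMem_span_of_exponents [IsDomain R] {h v : R} (hv : Prime v) (hvh : ¬ v ∣ h) {p : Ideal R}
    (hhp : h ∈ p) (hvp : v ∈ p) {N k : ℕ} (hk : k ≤ N) {q : R} (hq : q ∉ p) {S : Set R}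
    (hS : ∀ x ∈ S, ∃ l ≤ N, l ≠ k ∧ h ^ (N - l) * v ^ l ∣ x) :
    h ^ (N - k) * v ^ k * q ∉ Ideal.span S := by
  intro hmem
  have hh0 : h ≠ 0 := by rintro rfl; exact hvh (dvd_zero v)
  -- A product with `l < k` has too large a power of `h`, one with `l > k` too large a power of `v`.
  -- Cancelling `h ^ (N - k) * v ^ k` then forces `q ∈ (h, v) ≤ p`.
  have hle : Ideal.span S ≤ Ideal.span {h ^ (N - k + 1), v ^ (k + 1)} := by
    rw [Ideal.span_le]
    intro x hx
    obtain ⟨l, hl, hlk, hd⟩ := hS x hx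
    refine Ideal.mem_of_dvd _ hd ?_
    rcases lt_or_gt_of_ne hlk with h1 | h1
    · exact Ideal.mem_of_dvd _ ((pow_dvd_pow h (by omega : N - k + 1 ≤ N - l)).mul_right _)
        (Ideal.subset_span (by simp))
    · exact Ideal.mem_of_dvd _ ((pow_dvd_pow v (by omega : k + 1 ≤ l)).mul_left _)
        (Ideal.subset_span (by simp))
  obtain ⟨x, y, hxy⟩ := Ideal.mem_span_pair.1 (hle hmem)
  have e1 : v ^ (k + 1) ∣ h ^ (N - k) * (v ^ k * q - x * h) :=
    ⟨y, by linear_combination -hxy⟩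
  obtain ⟨w, hw⟩ := hv.pow_dvd_of_dvd_mul_left _ (fun hd => hvh (hv.dvd_of_dvd_pow hd)) e1
  have e2 : v ^ k ∣ h * x := ⟨q - v * w, by linear_combination -hw⟩
  obtain ⟨x', rfl⟩ := hv.pow_dvd_of_dvd_mul_left _ hvh e2
  have e3 : v ^ k * q = v ^ k * (x' * h + v * w) := by linear_combination hw
  rw [mul_right_inj' (pow_ne_zero _ hv.ne_zero)] at e3
  exact hq (e3 ▸ add_mem (Ideal.mul_mem_left _ _ hhp) (Ideal.mul_mem_right _ _ hvp))

end Generators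

/-! ### Ideals in tensor products over a field -/

section TensorKernels

open scoped TensorProduct
open Algebra.TensorProduct (includeLeft includeRight)

variable {A B : Type*} [CommRing A] [CommRing B] [Algebra K A] [Algebra K B]

/-- The ideal `I ⊗ B + A ⊗ J` of `A ⊗ B`. -/
noncomputable def tensorSum (I : Ideal A) (J : Ideal B) : Ideal (A ⊗[K] B) :=
  I.map (includeLeft : A →ₐ[K] A ⊗[K] B) ⊔ J.map (includeRight : B →ₐ[K] A ⊗[K] B)

theorem tensorSum_mono {I I' : Ideal A} {J J' : Ideal B} (hI : I ≤ I') (hJ : J ≤ J') :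
    tensorSum (K := K) I J ≤ tensorSum I' J' :=
  sup_le_sup (Ideal.map_mono hI) (Ideal.map_mono hJ)

/-- Over a field the kernel of `F ⊗ G` is generated by the kernels of `F` and `G`,
without surjectivity assumptions. -/
theorem ker_tensorMap {A' B' : Type*} [CommRing A'] [CommRing B'] [Algebra K A'] [Algebra K B']
    (F : A →ₐ[K] A') (G : B →ₐ[K] B') :
    RingHom.ker (Algebra.TensorProduct.map F G) =
      tensorSum (RingHom.ker F) (RingHom.ker G) := by
  -- Factor through the images: the tensor product of the two inclusions is injective by flatness
  -- over a field.
  have hcomp : Algebra.TensorProduct.map F G =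
      (Algebra.TensorProduct.map F.range.val G.range.val).comp
        (Algebra.TensorProduct.map F.rangeRestrict G.rangeRestrict) := by
    ext <;> simp
  have hinj : Function.Injective (Algebra.TensorProduct.map F.range.val G.range.val) :=
    TensorProduct.map_injective_of_flat_flat F.range.val.toLinearMap G.range.val.toLinearMap
      Subtype.val_injective Subtype.val_injective
  have hker := Algebra.TensorProduct.map_ker (f := F.rangeRestrict) (g := G.rangeRestrict)
    F.rangeRestrict_surjective G.rangeRestrict_surjective
  rw [AlgHom.ker_rangeRestrict, AlgHom.ker_rangeRestrict] at hker
  rw [tensorSum, ← hker]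
  ext x
  rw [RingHom.mem_ker, RingHom.mem_ker, hcomp, AlgHom.comp_apply,
    map_eq_zero_iff _ hinj]

theorem eq_zero_of_proj_tensor {ι κ : Type*} [Fintype ι] [Fintype κ] {M : ι → Type*}
    {N : κ → Type*} [∀ i, AddCommGroup (M i)] [∀ i, Module K (M i)] [∀ j, AddCommGroup (N j)]
    [∀ j, Module K (N j)] (x : (∀ i, M i) ⊗[K] (∀ j, N j))
    (h : ∀ i j, TensorProduct.map (LinearMap.proj i) (LinearMap.proj j) x = (0 : M i ⊗[K] N j)) :
    x = 0 := by
  classical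
  have hL : ∀ i (y : (∀ i, M i) ⊗[K] (∀ j, N j)), TensorProduct.piLeft K (∀ j, N j) M y i =
      TensorProduct.map (LinearMap.proj i) LinearMap.id y := by
    intro i y
    induction y with
    | zero => simp
    | tmul a b => simp
    | add a b ha hb => rw [map_add, map_add, Pi.add_apply, ha, hb]
  have hR : ∀ i j (y : M i ⊗[K] (∀ j, N j)), TensorProduct.piRight K K (M i) N y j =
      TensorProduct.map LinearMap.id (LinearMap.proj j) y := by
    intro i j y
    induction y with
    | zero => simp
    | tmul a b => simp
    | add a b ha hb => rw [map_add, map_add, Pi.add_apply, ha, hb]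
  rw [← (TensorProduct.piLeft K (∀ j, N j) M).map_eq_zero_iff]
  ext1 i
  rw [Pi.zero_apply, ← (TensorProduct.piRight K K (M i) N).map_eq_zero_iff]
  ext1 j
  rw [hR, hL, ← LinearMap.comp_apply, ← TensorProduct.map_comp, LinearMap.id_comp,
    LinearMap.comp_id, h, Pi.zero_apply]

/-- Both sides are kernels: the intersections are kernels of the maps `F`, `G` into finite products
of quotients, and tensor products commute with finite products. -/
theorem mem_tensorSum_iInf {ι κ : Type*} [Fintype ι] [Fintype κ] {I : ι → Ideal A}
    {J : κ → Ideal B} {x : A ⊗[K] B} (h : ∀ i j, x ∈ tensorSum (I i) (J j)) :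
    x ∈ tensorSum (⨅ i, I i) (⨅ j, J j) := by
  let F : A →ₐ[K] ∀ i, A ⧸ I i := AlgHom.pi fun i => Ideal.Quotient.mkₐ K (I i)
  let G : B →ₐ[K] ∀ j, B ⧸ J j := AlgHom.pi fun j => Ideal.Quotient.mkₐ K (J j)
  have hF : RingHom.ker F = ⨅ i, I i := by
    ext a
    simp [F, RingHom.mem_ker, funext_iff, Ideal.Quotient.eq_zero_iff_mem]
  have hG : RingHom.ker G = ⨅ j, J j := by
    ext a
    simp [G, RingHom.mem_ker, funext_iff, Ideal.Quotient.eq_zero_iff_mem]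
  rw [← hF, ← hG, ← ker_tensorMap, RingHom.mem_ker]
  refine eq_zero_of_proj_tensor (K := K) _ fun i j => ?_
  have hij := h i j
  have hker := ker_tensorMap (Ideal.Quotient.mkₐ K (I i)) (Ideal.Quotient.mkₐ K (J j))
  rw [show RingHom.ker (Ideal.Quotient.mkₐ K (I i)) = I i from Ideal.Quotient.mkₐ_ker K (I i),
    show RingHom.ker (Ideal.Quotient.mkₐ K (J j)) = J j from Ideal.Quotient.mkₐ_ker K (J j)] at hker
  rw [← hker, RingHom.mem_ker] at hij
  rw [← hij]
  change (TensorProduct.map _ _) (TensorProduct.map F.toLinearMap G.toLinearMap x) = _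
  rw [← LinearMap.comp_apply, ← TensorProduct.map_comp]
  rfl

theorem map_mem_of_mem_tensorSum {C : Type*} [CommRing C] [Algebra K C] {I : Ideal A} {J : Ideal B}
    {E : Ideal C} (Φ : A ⊗[K] B →ₐ[K] C) (hI : ∀ a ∈ I, Φ (a ⊗ₜ 1) ∈ E)
    (hJ : ∀ b ∈ J, Φ (1 ⊗ₜ b) ∈ E) {x : A ⊗[K] B} (hx : x ∈ tensorSum I J) : Φ x ∈ E := by
  have : tensorSum (K := K) I J ≤ E.comap Φ :=
    sup_le (Ideal.map_le_iff_le_comap.2 hI) (Ideal.map_le_iff_le_comap.2 hJ)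
  exact this hx

/-- `D` is only `K`-linear, so `I ⊗ B` and `A ⊗ J` are treated as images of linear maps and checked
on pure tensors. -/
theorem map_tmul_mem_tensorSum {I I' : Ideal A} {J : Ideal B} {D : A →ₗ[K] A}
    (hD : ∀ a ∈ I, D a ∈ I') {x : A ⊗[K] B} (hx : x ∈ tensorSum I J) :
    D.rTensor B x ∈ tensorSum I' J := by
  obtain ⟨y, hy, z, hz, rfl⟩ := Submodule.mem_sup.1 hx
  rw [map_add]
  refine add_mem ?_ ?_
  · have hy' : y ∈ (I.map (includeLeft : A →ₐ[K] A ⊗[K] B)).restrictScalars K := hy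
    rw [Ideal.map_includeLeft_eq] at hy'
    obtain ⟨w, rfl⟩ := hy'
    clear hy hx
    refine Ideal.mem_sup_left ?_
    induction w with
    | zero => simp
    | tmul a b =>
      have : D.rTensor B ((LinearMap.rTensor B (Submodule.subtype (I.restrictScalars K)))
          (a ⊗ₜ b)) = (1 ⊗ₜ[K] b) * (includeLeft : A →ₐ[K] A ⊗[K] B) (D a) := by simp
      rw [this]
      exact Ideal.mul_mem_left _ _ (Ideal.mem_map_of_mem _ (hD _ a.2))
    | add a b ha hb =>
      rw [map_add, map_add]
      exact add_mem ha hb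
  · have hz' : z ∈ (J.map (includeRight : B →ₐ[K] A ⊗[K] B)).restrictScalars K := hz
    rw [Ideal.map_includeRight_eq] at hz'
    obtain ⟨w, rfl⟩ := hz'
    clear hz hx
    refine Ideal.mem_sup_right ?_
    induction w with
    | zero => simp
    | tmul a b =>
      have : D.rTensor B ((LinearMap.lTensor A (Submodule.subtype (J.restrictScalars K)))
          (a ⊗ₜ b)) = (D a ⊗ₜ[K] 1) * (includeRight : B →ₐ[K] A ⊗[K] B) b := by simp
      rw [this]
      exact Ideal.mul_mem_left _ _ (Ideal.mem_map_of_mem _ b.2)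
    | add a b ha hb =>
      rw [map_add, map_add]
      exact add_mem ha hb

/-- In each binomial term of total degree `m + n + 1`, either `I` occurs at least `m + 1` times or
`J` at least `n + 1` times. -/
theorem sup_pow_le_pow_sup_pow {I J : Ideal A} (m n : ℕ) :
    (I ⊔ J) ^ (m + n + 1) ≤ I ^ (m + 1) ⊔ J ^ (n + 1) := by
  rw [← Submodule.add_eq_sup, add_pow]
  refine Finset.sum_induction _ (· ≤ I ^ (m + 1) ⊔ J ^ (n + 1))
    (fun _ _ h1 h2 => sup_le h1 h2) bot_le fun k _ => ?_
  refine Ideal.mul_le_left.trans ?_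
  rcases Nat.lt_or_ge m k with h | h
  · exact le_sup_of_le_left (Ideal.mul_le_left.trans (Ideal.pow_le_pow_right h))
  · exact le_sup_of_le_right (Ideal.mul_le_right.trans (Ideal.pow_le_pow_right (by omega)))

theorem derivation_mem_pow (D : Derivation K A A) {p : Ideal A} (e : ℕ) {f : A}
    (hf : f ∈ p ^ (e + 1)) : D f ∈ p ^ e := by
  induction e generalizing f with
  | zero => simp
  | succ e ih =>
    rw [pow_succ'] at hf
    refine Submodule.mul_induction_on hf (fun x hx y hy => ?_) fun x y hx hy => ?_
    · rw [D.leibniz, smul_eq_mul, smul_eq_mul]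
      refine add_mem ?_ (Ideal.mul_mem_right _ _ hy)
      rw [pow_succ']
      exact Ideal.mul_mem_mul hx (ih hy)
    · rw [map_add]
      exact add_mem hx hy

end TensorKernels

/-! ### Hadamard products of ideals through the comultiplication -/

section Hadamard

open scoped TensorProduct
open Algebra.TensorProduct (includeLeft includeRight)

/-- The comultiplication `x_c ↦ x_c ⊗ x_c` dual to the Hadamard product. -/
noncomputable def comul (K : Type*) [Field K] : Poly K →ₐ[K] Poly K ⊗[K] Poly K := aeval fun c => X c ⊗ₜ X c

/-- Eliminating `x` by `x_c = y_c z_c` identifies `K[x, y, z]` modulo these relations with `K[y] ⊗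
K[z]`. -/
theorem mem_idealMul (I J : Ideal (Poly K)) (f : Poly K) :
    f ∈ idealMul I J ↔ comul K f ∈ tensorSum I J := by
  set ry : Poly K →ₐ[K] MvPolynomial (Fin 3 ⊕ Fin 3 ⊕ Fin 3) K :=
    rename (fun i : Fin 3 => (Sum.inr (Sum.inl i) : Fin 3 ⊕ Fin 3 ⊕ Fin 3)) with hry
  set rz : Poly K →ₐ[K] MvPolynomial (Fin 3 ⊕ Fin 3 ⊕ Fin 3) K :=
    rename (fun i : Fin 3 => (Sum.inr (Sum.inr i) : Fin 3 ⊕ Fin 3 ⊕ Fin 3)) with hrz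
  set rx : Poly K →ₐ[K] MvPolynomial (Fin 3 ⊕ Fin 3 ⊕ Fin 3) K :=
    rename (Sum.inl : Fin 3 → Fin 3 ⊕ Fin 3 ⊕ Fin 3) with hrx
  let E := Ideal.map ry I ⊔ Ideal.map rz J ⊔ Ideal.span (Set.range fun i : Fin 3 =>
        (X (Sum.inl i) - X (Sum.inr (Sum.inl i)) * X (Sum.inr (Sum.inr i)) :
            MvPolynomial (Fin 3 ⊕ Fin 3 ⊕ Fin 3) K))
  let Ψ : MvPolynomial (Fin 3 ⊕ Fin 3 ⊕ Fin 3) K →ₐ[K] Poly K ⊗[K] Poly K :=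
    aeval (Sum.elim (fun c => X c ⊗ₜ X c) (Sum.elim (fun c => X c ⊗ₜ 1) fun c => 1 ⊗ₜ X c))
  let σ : Poly K ⊗[K] Poly K →ₐ[K] MvPolynomial (Fin 3 ⊕ Fin 3 ⊕ Fin 3) K :=
    Algebra.TensorProduct.productMap ry rz
  have hΨx : Ψ.comp rx = comul K := by ext c; simp [Ψ, hrx, comul]
  have hΨy : Ψ.comp ry = includeLeft := by ext c; simp [Ψ, hry]
  have hΨz : Ψ.comp rz = includeRight := by ext c; simp [Ψ, hrz]
  change rx f ∈ E ↔ _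
  constructor
  · intro hf
    have hE : E ≤ (tensorSum I J).comap Ψ := by
      refine sup_le (sup_le (Ideal.map_le_iff_le_comap.2 fun p hp => ?_)
        (Ideal.map_le_iff_le_comap.2 fun p hp => ?_)) (Ideal.span_le.2 ?_)
      · rw [Ideal.mem_comap, Ideal.mem_comap, ← AlgHom.comp_apply, hΨy]
        exact Ideal.mem_sup_left (Ideal.mem_map_of_mem _ hp)
      · rw [Ideal.mem_comap, Ideal.mem_comap, ← AlgHom.comp_apply, hΨz]
        exact Ideal.mem_sup_right (Ideal.mem_map_of_mem _ hp)
      · rintro _ ⟨c, rfl⟩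
        rw [SetLike.mem_coe, Ideal.mem_comap]
        have : Ψ (X (Sum.inl c) - X (Sum.inr (Sum.inl c)) * X (Sum.inr (Sum.inr c))) = 0 := by
          simp [Ψ]
        rw [this]
        exact zero_mem _
    have := hE hf
    rwa [Ideal.mem_comap, ← AlgHom.comp_apply, hΨx] at this
  · intro hf
    have h1 : σ (comul K f) ∈ E := by
      refine map_mem_of_mem_tensorSum σ (fun p hp => ?_) (fun p hp => ?_) hf
      · rw [Algebra.TensorProduct.productMap_apply_tmul, map_one, mul_one]
        exact Ideal.mem_sup_left (Ideal.mem_sup_left (Ideal.mem_map_of_mem _ hp))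
      · rw [Algebra.TensorProduct.productMap_apply_tmul, map_one, one_mul]
        exact Ideal.mem_sup_left (Ideal.mem_sup_right (Ideal.mem_map_of_mem _ hp))
    have h2 : ((Ideal.Quotient.mkₐ K E).comp σ).comp (comul K) = (Ideal.Quotient.mkₐ K E).comp rx := by
      ext c
      simp only [AlgHom.comp_apply, comul, aeval_X, Ideal.Quotient.mkₐ_eq_mk]
      rw [eq_comm, Ideal.Quotient.eq]
      refine Ideal.mem_sup_right (Ideal.subset_span ⟨c, ?_⟩)
      simp [σ, hrx, hry, hrz]
    have h3 := DFunLike.congr_fun h2 f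
    simp only [AlgHom.comp_apply, Ideal.Quotient.mkₐ_eq_mk] at h3
    rw [Ideal.Quotient.eq_zero_iff_mem.2 h1] at h3
    exact Ideal.Quotient.eq_zero_iff_mem.1 h3.symm

/-- Monomials are eigenvectors of `x_c ∂_c` and `comul` sends a monomial `u` to `u ⊗ u`, so the
operator may act on the left factor alone. -/
theorem comul_X_mul_pderiv (c : Fin 3) (f : Poly K) :
    comul K (X c * pderiv c f) =
      (((X c : Poly K) • pderiv (R := K) c : Derivation K (Poly K) (Poly K)) :
        Poly K →ₗ[K] Poly K).rTensor (Poly K) (comul K f) := by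
  induction f using MvPolynomial.induction_on' with
  | monomial m a =>
    have hm : comul K (monomial m a) = a • (monomial m (1 : K) ⊗ₜ[K] monomial m (1 : K)) := by
      have h1 : ∀ u : Fin 3 →₀ ℕ, (monomial u (1 : K)) = ∏ i, X i ^ u i := fun u => by
        rw [monomial_eq, C_1, one_mul, Finsupp.prod_fintype _ _ (by simp)]
      rw [show monomial m a = a • monomial m (1 : K) by simp [smul_monomial], map_smul, h1]
      congr 1
      simp [comul, Fin.prod_univ_three, Algebra.TensorProduct.tmul_pow,
        Algebra.TensorProduct.tmul_mul_tmul]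
    rw [X_mul_pderiv_monomial, map_nsmul, hm, map_smul, LinearMap.rTensor_tmul]
    simp only [Derivation.coeFn_coe, Derivation.smul_apply, smul_eq_mul, X_mul_pderiv_monomial]
    rw [smul_comm, TensorProduct.smul_tmul']
  | add p q hp hq => simp only [map_add, mul_add, hp, hq]

theorem comul_mem_of_mem_pow {v w : Fin 3 → K} (hv : v 0 ≠ 0) (hw : w 0 ≠ 0) (m n : ℕ)
    {f : Poly K} (hf : f ∈ coneIdeal (v * w) ^ (m + n + 1)) :
    comul K f ∈ tensorSum (coneIdeal v ^ (m + 1)) (coneIdeal w ^ (n + 1)) := by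
  have hvw : (v * w) 0 ≠ 0 := mul_ne_zero hv hw
  have h1 : (coneIdeal (v * w)).map (comul K) ≤ tensorSum (K := K) (coneIdeal v) (coneIdeal w) := by
    rw [coneIdeal_eq_span hvw, Ideal.map_span, Ideal.span_le]
    rintro _ ⟨_, ⟨c, rfl⟩, rfl⟩
    have : comul K (localParam (v * w) c) =
        (1 ⊗ₜ[K] X c) * (includeLeft : Poly K →ₐ[K] Poly K ⊗[K] Poly K) (localParam v c) +
          ((C (v c / v 0) * X 0) ⊗ₜ[K] 1) *
            (includeRight : Poly K →ₐ[K] Poly K ⊗[K] Poly K) (localParam w c) := by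
      have e1 : comul K (localParam (v * w) c) = X c ⊗ₜ X c -
          (v c / v 0 * (w c / w 0)) • (X 0 ⊗ₜ X 0) := by
        rw [localParam, map_sub, ← smul_eq_C_mul, map_smul]
        simp only [comul, aeval_X, Pi.mul_apply, mul_div_mul_comm]
      rw [e1, Algebra.TensorProduct.includeLeft_apply, Algebra.TensorProduct.includeRight_apply,
        Algebra.TensorProduct.tmul_mul_tmul, Algebra.TensorProduct.tmul_mul_tmul]
      simp only [localParam, one_mul, mul_one, ← smul_eq_C_mul, TensorProduct.sub_tmul,
        TensorProduct.tmul_sub, TensorProduct.tmul_smul, ← TensorProduct.smul_tmul', smul_smul]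
      rw [mul_comm (w c / w 0)]
      abel
    rw [this]
    have hmem : ∀ (u : Fin 3 → K) (_ : u 0 ≠ 0) (c : Fin 3), localParam u c ∈ coneIdeal u := by
      intro u hu c
      rw [coneIdeal_eq_span hu]
      exact Ideal.subset_span ⟨c, rfl⟩
    exact add_mem
      (Ideal.mul_mem_left _ _ (Ideal.mem_sup_left (Ideal.mem_map_of_mem _ (hmem v hv c))))
      (Ideal.mul_mem_left _ _ (Ideal.mem_sup_right (Ideal.mem_map_of_mem _ (hmem w hw c))))
  have h2 := Ideal.mem_map_of_mem (comul K) hf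
  rw [Ideal.map_pow] at h2
  have h3 := sup_pow_le_pow_sup_pow m n (Ideal.pow_right_mono h1 _ h2)
  rwa [← Ideal.map_pow, ← Ideal.map_pow] at h3

/-- Substituting `y = v` and `z_c = x_c / v_c` is a left inverse of `comul`; it kills the ideal of
`v` and carries that of `w` into that of `v * w`. -/
theorem mem_of_comul_mem_left {v w : Fin 3 → K} (hv : ∀ c, v c ≠ 0) (hw : w 0 ≠ 0) (n : ℕ)
    {f : Poly K} (hf : comul K f ∈ tensorSum (coneIdeal v) (coneIdeal w ^ n)) :
    f ∈ coneIdeal (v * w) ^ n := by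
  have hvw : (v * w) 0 ≠ 0 := mul_ne_zero (hv 0) hw
  let ρ : Poly K →ₐ[K] Poly K := aeval fun c => C (v c)
  let τ : Poly K →ₐ[K] Poly K := aeval fun c => C (v c)⁻¹ * X c
  let Φ : Poly K ⊗[K] Poly K →ₐ[K] Poly K := Algebra.TensorProduct.productMap ρ τ
  have hid : Φ.comp (comul K) = AlgHom.id K (Poly K) := by
    ext1 c
    simp only [Φ, ρ, τ, comul, AlgHom.comp_apply, aeval_X,
      Algebra.TensorProduct.productMap_apply_tmul, AlgHom.id_apply]
    rw [← mul_assoc, ← C_mul, mul_inv_cancel₀ (hv c), C_1, one_mul]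
  have hρ : (coneIdeal v).map ρ ≤ ⊥ := by
    rw [coneIdeal_eq_span (hv 0), Ideal.map_span, Ideal.span_le]
    rintro _ ⟨_, ⟨c, rfl⟩, rfl⟩
    have : (C (v c) : Poly K) - C (v c / v 0) * C (v 0) = 0 := by
      rw [← C_mul, div_mul_cancel₀ _ (hv 0), sub_self]
    simpa [localParam, ρ, algebraMap_eq] using this
  have hτ : (coneIdeal w).map τ ≤ coneIdeal (v * w) := by
    rw [coneIdeal_eq_span hw, coneIdeal_eq_span hvw, Ideal.map_span, Ideal.span_le]
    rintro _ ⟨_, ⟨c, rfl⟩, rfl⟩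
    have : τ (localParam w c) = C (v c)⁻¹ * localParam (v * w) c := by
      have hc : (w c / w 0) * (v 0)⁻¹ = (v c)⁻¹ * (v c * w c / (v 0 * w 0)) := by
        have := hv c
        have := hv 0
        field_simp
      have hC := congrArg (C : K → Poly K) hc
      rw [C_mul, C_mul] at hC
      simp only [localParam, τ, map_sub, map_mul, aeval_X, Pi.mul_apply, algHom_C, algebraMap_eq]
      linear_combination (-X 0) * hC
    rw [this]
    exact Ideal.mul_mem_left _ _ (Ideal.subset_span ⟨c, rfl⟩)
  have : Φ (comul K f) ∈ coneIdeal (v * w) ^ n := by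
    refine map_mem_of_mem_tensorSum Φ (fun p hp => ?_) (fun p hp => ?_) hf
    · rw [Algebra.TensorProduct.productMap_apply_tmul, map_one, mul_one]
      have := hρ (Ideal.mem_map_of_mem ρ hp)
      rw [Ideal.mem_bot] at this
      rw [this]
      exact zero_mem _
    · rw [Algebra.TensorProduct.productMap_apply_tmul, map_one, one_mul]
      have := Ideal.mem_map_of_mem τ hp
      rw [Ideal.map_pow] at this
      exact Ideal.pow_right_mono hτ n this
  rwa [← AlgHom.comp_apply, hid] at this

/-- Induction on `m`: `x_c ∂_c` lowers the order at `v` by one, and `x_c` can be cancelled because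
it does not vanish at `v * w`. The derivative criterion then raises the order of `f`. -/
theorem mem_of_comul_mem [CharZero K] {v w : Fin 3 → K} (hv : ∀ c, v c ≠ 0)
    (hw : ∀ c, w c ≠ 0) (m n : ℕ) {f : Poly K}
    (hf : comul K f ∈ tensorSum (coneIdeal v ^ (m + 1)) (coneIdeal w ^ (n + 1))) :
    f ∈ coneIdeal (v * w) ^ (m + n + 1) := by
  have hvw : (v * w) 0 ≠ 0 := mul_ne_zero (hv 0) (hw 0)
  induction m generalizing f with
  | zero =>
    rw [zero_add, pow_one] at hf
    rw [zero_add]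
    exact mem_of_comul_mem_left hv (hw 0) _ hf
  | succ m ih =>
    rw [show m + 1 + n + 1 = (m + n + 1) + 1 by omega]
    refine mem_coneIdeal_pow_succ_of_pderiv hvw ?_ fun c => ?_
    · have := mem_of_comul_mem_left hv (hw 0) _
        (tensorSum_mono (Ideal.pow_le_self (by omega)) le_rfl hf)
      exact Ideal.pow_le_self (by omega) this
    · refine mem_coneIdeal_pow_of_mul_mem hvw (g := X c) ?_ (ih ?_)
      · rw [mem_coneIdeal_of_isHomogeneous _ (isHomogeneous_X K c), eval_X]
        exact mul_ne_zero (hv c) (hw c)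
      · rw [comul_X_mul_pderiv]
        exact map_tmul_mem_tensorSum (fun a ha => derivation_mem_pow _ _ ha) hf

end Hadamard

/-! ### Products of points, fat point ideals and minimal generating sets -/

theorem exists_rep_pointMul (p q : Plane K) (h : p.rep * q.rep ≠ 0) :
    ∃ a : K, a ≠ 0 ∧ (pointMul p q h).rep = a • (p.rep * q.rep) := by
  obtain ⟨a, ha⟩ := Projectivization.exists_smul_eq_mk_rep K (p.rep * q.rep) h
  exact ⟨a, a.ne_zero, ha.symm⟩

theorem pointIdeal_pointMul {p q : Plane K} (hp : OffCoordinateLines p)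
    (hq : OffCoordinateLines q) (h : p.rep * q.rep ≠ 0) :
    pointIdeal (pointMul p q h) = coneIdeal (p.rep * q.rep) := by
  obtain ⟨a, ha, hrep⟩ := exists_rep_pointMul p q h
  have h0 : (p.rep * q.rep) 0 ≠ 0 := mul_ne_zero (hp 0) (hq 0)
  rw [pointIdeal_eq_coneIdeal (by rw [hrep]; exact mul_ne_zero ha h0), hrep, coneIdeal_smul h0 ha]

theorem pointMul_comm (p q : Plane K) (h : p.rep * q.rep ≠ 0) (h' : q.rep * p.rep ≠ 0) :
    pointMul p q h = pointMul q p h' := by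
  simp only [pointMul, mul_comm]

theorem mem_coneIdeal_of_pointMul_mem_zeroSet {p q : Plane K} (hp : OffCoordinateLines p)
    (hq : OffCoordinateLines q) (h : p.rep * q.rep ≠ 0) {f : Poly K} (hf : f.IsHomogeneous 1)
    (hz : pointMul p q h ∈ zeroSet f) : f ∈ coneIdeal (p.rep * q.rep) := by
  rw [← pointIdeal_pointMul hp hq h]
  exact Ideal.subset_span ⟨⟨1, hf⟩, hz⟩

/-- The parameters of the first point vanish at the second, so the coordinate vectors are
proportional. -/
theorem pointMul_eq_of_coneIdeal_le {p q p' q' : Plane K} (hp : OffCoordinateLines p)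
    (hq : OffCoordinateLines q) (h : p.rep * q.rep ≠ 0) (h' : p'.rep * q'.rep ≠ 0)
    (hle : coneIdeal (p.rep * q.rep) ≤ coneIdeal (p'.rep * q'.rep)) :
    pointMul p q h = pointMul p' q' h' := by
  have h0 : (p.rep * q.rep) 0 ≠ 0 := mul_ne_zero (hp 0) (hq 0)
  set v := p.rep * q.rep
  set w := p'.rep * q'.rep
  rw [eq_comm, pointMul, pointMul, Projectivization.mk_eq_mk_iff']
  refine ⟨w 0 / v 0, ?_⟩
  ext c
  have hc : localParam v c ∈ coneIdeal w := by
    refine hle ?_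
    rw [coneIdeal_eq_span h0]
    exact Ideal.subset_span ⟨c, rfl⟩
  rw [mem_coneIdeal_of_isHomogeneous _ (localParam_isHomogeneous v c)] at hc
  simp only [localParam, map_sub, map_mul, eval_X, eval_C] at hc
  change w 0 / v 0 * v c = w c
  rw [sub_eq_zero.1 hc]
  ring

theorem idealMul_fatIdeal [CharZero K] {ι κ : Type*} [Fintype ι] [Fintype κ] {P : ι → Plane K}
    {Q : κ → Plane K} (hP : ∀ i, OffCoordinateLines (P i)) (hQ : ∀ j, OffCoordinateLines (Q j))
    {m : ι → ℕ} {n : κ → ℕ} (hm : ∀ i, 0 < m i) (hn : ∀ j, 0 < n j) :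
    idealMul (fatIdeal P m) (fatIdeal Q n) =
      fatIdeal (fun ij : ι × κ => pointMul (P ij.1) (Q ij.2)
        ((hP ij.1).mul_rep_ne_zero (hQ ij.2))) (fun ij => m ij.1 + n ij.2 - 1) := by
  ext f
  rw [mem_idealMul, fatIdeal, fatIdeal, fatIdeal, Ideal.mem_iInf]
  simp only [pointIdeal_pointMul (hP _) (hQ _), pointIdeal_eq_coneIdeal (hP _ 0),
    pointIdeal_eq_coneIdeal (hQ _ 0)]
  constructor
  · rintro hf ⟨i, j⟩
    obtain ⟨m', hm'⟩ := Nat.exists_eq_succ_of_ne_zero (hm i).ne'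
    obtain ⟨n', hn'⟩ := Nat.exists_eq_succ_of_ne_zero (hn j).ne'
    have := tensorSum_mono (iInf_le _ i) (iInf_le _ j) hf
    rw [hm', hn'] at this
    dsimp only
    rw [hm', hn', show m'.succ + n'.succ - 1 = m' + n' + 1 by omega]
    exact mem_of_comul_mem (hP i) (hQ j) m' n' this
  · intro hf
    refine mem_tensorSum_iInf fun i j => ?_
    obtain ⟨m', hm'⟩ := Nat.exists_eq_succ_of_ne_zero (hm i).ne'
    obtain ⟨n', hn'⟩ := Nat.exists_eq_succ_of_ne_zero (hn j).ne'
    have := hf (i, j)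
    dsimp only at this
    rw [hm', hn', show m'.succ + n'.succ - 1 = m' + n' + 1 by omega] at this
    rw [hm', hn']
    exact comul_mem_of_mem_pow (hP i 0) (hQ j 0) m' n' this

theorem isMinimalGeneratingSet_range {ι : Type*} {g : ι → Poly K} {I : Ideal (Poly K)}
    (hI : Ideal.span (Set.range g) = I) (hg : ∀ k, g k ∉ Ideal.span (g '' {l | l ≠ k})) :
    IsMinimalGeneratingSet I (Set.range g) := by
  refine ⟨hI, fun S hS hSg => ?_⟩
  rintro _ ⟨k, rfl⟩
  by_contra hk
  refine hg k (Ideal.span_mono (s := S) (fun x hx => ?_) ?_)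
  · obtain ⟨l, rfl⟩ := hSg hx
    exact ⟨l, fun hl => hk (hl ▸ hx), rfl⟩
  · rw [hS, ← hI]
    exact Ideal.subset_span ⟨k, rfl⟩

theorem injective_of_notMem_span {ι : Type*} {g : ι → Poly K}
    (hg : ∀ k, g k ∉ Ideal.span (g '' {l | l ≠ k})) : Function.Injective g := by
  intro k l hkl
  by_contra hne
  exact hg k (hkl ▸ Ideal.subset_span ⟨l, Ne.symm hne, rfl⟩)

end HadamardGrid

/-! ### The theorem for the grid -/

theorem theorem5p9 {K : Type*} [Field K] [IsAlgClosed K] {r s : ℕ} (hr : 0 < r) (hs : 0 < s)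
    -- collinear points `P₁, …, P_r` and `Q₁, …, Q_s` outside the coordinate lines
    (P : Fin r → HadamardGrid.Plane K) (Q : Fin s → HadamardGrid.Plane K)
    (hP : ∀ i, HadamardGrid.OffCoordinateLines (P i))
    (hQ : ∀ j, HadamardGrid.OffCoordinateLines (Q j))
    (lP lQ : Set (HadamardGrid.Plane K))
    (hlP : HadamardGrid.IsLine lP) (hlQ : HadamardGrid.IsLine lQ)
    (hPl : ∀ i, P i ∈ lP) (hQl : ∀ j, Q j ∈ lQ)
    -- the products `P_i ⋆ Q_j` are pairwise distinct
    (hdist : Function.Injective fun ij : Fin r × Fin s =>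
      HadamardGrid.pointMul (P ij.1) (Q ij.2) ((hP ij.1).mul_rep_ne_zero (hQ ij.2)))
    -- and they form a grid: no horizontal line is a vertical line
    (hgrid : ∀ i j, HadamardGrid.setMul lQ {P i} ≠ HadamardGrid.setMul lP {Q j})
    -- positive multiplicities in non-decreasing order
    (m : Fin r → ℕ) (n : Fin s → ℕ) (hm : ∀ i, 0 < m i) (hn : ∀ j, 0 < n j)
    (hm_mono : Monotone m) (hn_mono : Monotone n)
    -- their largest values `m_r` and `n_s`
    (mr ns : ℕ) (hmr : mr = m ⟨r - 1, Nat.sub_one_lt_of_lt hr⟩)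
    (hns : ns = n ⟨s - 1, Nat.sub_one_lt_of_lt hs⟩)
    -- linear forms of the lines `ℓ_Q ⋆ P_{r-i+1}` and `ℓ_P ⋆ Q_{s-j+1}`
    (H : Fin r → HadamardGrid.Poly K) (V : Fin s → HadamardGrid.Poly K)
    (hH : ∀ i, HadamardGrid.DefinesLine (H i) (HadamardGrid.setMul lQ {P i.rev}))
    (hV : ∀ j, HadamardGrid.DefinesLine (V j) (HadamardGrid.setMul lP {Q j.rev}))
    -- `a_i = m_{r-i+1} + n_s - 1` and `b_j = n_{s-j+1} - n_s`
    (a : Fin r → ℤ) (b : Fin s → ℤ)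
    (ha : ∀ i, a i = (m i.rev : ℤ) + ns - 1) (hb : ∀ j, b j = (n j.rev : ℤ) - ns)
    -- the products of grid lines, for `k = 0, …, m_r + n_s - 1`
    (g : Fin (mr + ns) → HadamardGrid.Poly K)
    (hg : ∀ k, g k = HadamardGrid.gridProduct H V a b k) :
    Function.Injective g ∧
    (CharZero K → HadamardGrid.IsMinimalGeneratingSet
      (HadamardGrid.idealMul (HadamardGrid.fatIdeal P m) (HadamardGrid.fatIdeal Q n))
      (Set.range g)) ∧
    HadamardGrid.IsMinimalGeneratingSet
      (HadamardGrid.fatIdeal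
        (fun ij : Fin r × Fin s =>
          HadamardGrid.pointMul (P ij.1) (Q ij.2) ((hP ij.1).mul_rep_ne_zero (hQ ij.2)))
        (fun ij => m ij.1 + n ij.2 - 1))
      (Set.range g) := by
  open HadamardGrid in
  let I : Fin r → Fin s → Ideal (HadamardGrid.Poly K) := fun i j =>
    coneIdeal ((P i.rev).rep * (Q j.rev).rep)
  have hW : ∀ i j, ((P i).rep * (Q j).rep) 0 ≠ 0 := fun i j => mul_ne_zero (hP i 0) (hQ j 0)
  have hHI : ∀ i j, H i ∈ I i j := by
    intro i j
    refine mem_coneIdeal_of_pointMul_mem_zeroSet (hP _) (hQ _)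
      ((hP _).mul_rep_ne_zero (hQ _)) (hH i).2.1 ?_
    rw [(hH i).2.2]
    exact ⟨Q j.rev, hQl _, P i.rev, rfl, (hQ _).mul_rep_ne_zero (hP _), pointMul_comm ..⟩
  have hVI : ∀ i j, V j ∈ I i j := by
    intro i j
    refine mem_coneIdeal_of_pointMul_mem_zeroSet (hP _) (hQ _)
      ((hP _).mul_rep_ne_zero (hQ _)) (hV j).2.1 ?_
    rw [(hV j).2.2]
    exact ⟨P i.rev, hPl _, Q j.rev, rfl, (hP _).mul_rep_ne_zero (hQ _), rfl⟩
  have hzero : ∀ i j, zeroSet (H i) ≠ zeroSet (V j) := by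
    intro i j
    rw [(hH i).2.2, (hV j).2.2]
    exact hgrid _ _
  have hspan : ∀ i j, I i j = Ideal.span {H i, V j} := by
    intro i j
    apply le_antisymm
    · exact coneIdeal_le_span_pair (hH i).1 (hH i).2.1 (hV j).1 (hV j).2.1 (hzero i j) (hW _ _)
        ((mem_coneIdeal_of_isHomogeneous _ (hH i).2.1).1 (hHI i j))
        ((mem_coneIdeal_of_isHomogeneous _ (hV j).2.1).1 (hVI i j))
    · rw [Ideal.span_le]
      rintro x (rfl | rfl)
      exacts [hHI i j, hVI i j]
  -- Two grid lines through a common grid point meet only there, so distinctness of the products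
  -- determines both indices.
  have hpts : ∀ i j i' j', H i ∈ I i' j' → V j ∈ I i' j' → i = i' ∧ j = j' := by
    intro i j i' j' h1 h2
    have hle : I i j ≤ I i' j' := by
      rw [hspan, Ideal.span_le]
      rintro x (rfl | rfl)
      exacts [h1, h2]
    have := @hdist (i.rev, j.rev) (i'.rev, j'.rev)
      (pointMul_eq_of_coneIdeal_le (hP _) (hQ _) _ _ hle)
    simpa using this
  have hne : ∀ i i' j, i ≠ i' → H i ∉ I i' j := fun i i' j hii' h =>
    hii' (hpts i j i' j h (hVI i' j)).1
  have hneV : ∀ i j j', j ≠ j' → V j ∉ I i j' := fun i j j' hjj' h =>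
    hjj' (hpts i j i j' (hHI i j') h).2
  have hVprime : ∀ j, Prime (V j) := fun j => linear_prime (hV j).1 (hV j).2.1
  have hVH : ∀ i j, ¬ V j ∣ H i := by
    intro i j hd
    have hd' := (hVprime j).irreducible.dvd_symm
      (linear_prime (hH i).1 (hH i).2.1).irreducible hd
    refine hzero i j (Set.Subset.antisymm (fun p hp => ?_) fun p hp => ?_)
    · obtain ⟨u, hu⟩ := hd'
      rw [hu]
      simp only [zeroSet, Set.mem_ofPred_eq] at hp ⊢
      rw [map_mul, hp, zero_mul]
    · obtain ⟨u, hu⟩ := hd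
      rw [hu]
      simp only [zeroSet, Set.mem_ofPred_eq] at hp ⊢
      rw [map_mul, hp, zero_mul]
  have hnle : ∀ j, n j ≤ ns := fun j => hns ▸ hn_mono (Fin.mk_le_mk.2 (by have := j.2; omega))
  have hmle : ∀ i, m i ≤ mr := fun i => hmr ▸ hm_mono (Fin.mk_le_mk.2 (by have := i.2; omega))
  have hgk : ∀ k : ℕ, gridProduct H V a b k =
      (∏ i, H i ^ (m i.rev + ns - 1 - k)) * ∏ j, V j ^ (k - (ns - n j.rev)) := by
    intro k
    rw [gridProduct]
    congr 1
    · refine Finset.prod_congr rfl fun i _ => ?_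
      have := hm i.rev
      rw [ha, show ((m i.rev : ℤ) + ns - 1 - k).toNat = m i.rev + ns - 1 - k by omega]
    · refine Finset.prod_congr rfl fun j _ => ?_
      have := hnle j.rev
      rw [hb, show ((n j.rev : ℤ) - ns + k).toNat = k - (ns - n j.rev) by omega]
  have hexp : ∀ (i : Fin r) (j : Fin s), m i.rev + ns - 1 - (ns - n j.rev) = m i.rev + n j.rev - 1 := by
    intro i j
    have := hnle j.rev
    have := hm i.rev
    omega
  have hfat : fatIdeal (fun ij : Fin r × Fin s =>
        pointMul (P ij.1) (Q ij.2) ((hP ij.1).mul_rep_ne_zero (hQ ij.2)))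
      (fun ij => m ij.1 + n ij.2 - 1) =
      ⨅ ij : Fin r × Fin s, I ij.1.rev ij.2.rev ^ (m ij.1 + n ij.2 - 1) := by
    simp only [fatIdeal, pointIdeal_pointMul (hP _) (hQ _), I, Fin.rev_rev]
  have hgen : Ideal.span (Set.range g) = fatIdeal (fun ij : Fin r × Fin s =>
        pointMul (P ij.1) (Q ij.2) ((hP ij.1).mul_rep_ne_zero (hQ ij.2)))
      (fun ij => m ij.1 + n ij.2 - 1) := by
    rw [hfat]
    apply le_antisymm
    · rw [Ideal.span_le]
      rintro _ ⟨k, rfl⟩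
      rw [SetLike.mem_coe, Ideal.mem_iInf]
      rintro ⟨i, j⟩
      rw [hg, hgk]
      have h1 := Ideal.mul_mem_mul
        (Ideal.pow_mem_pow (hHI i.rev j.rev) (m i + ns - 1 - k))
        (Ideal.pow_mem_pow (hVI i.rev j.rev) (k - (ns - n j)))
      rw [← pow_add] at h1
      have := hnle j
      have := hm i
      refine Ideal.mem_of_dvd _ (mul_dvd_mul ?_ ?_) (Ideal.pow_le_pow_right
        (by dsimp only; omega) h1)
      · have := Finset.dvd_prod_of_mem (fun i => H i ^ (m i.rev + ns - 1 - k))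
          (Finset.mem_univ i.rev)
        rwa [Fin.rev_rev] at this
      · have := Finset.dvd_prod_of_mem (fun j => V j ^ ((k : ℕ) - (ns - n j.rev)))
          (Finset.mem_univ j.rev)
        rwa [Fin.rev_rev] at this
    · intro f hf
      rw [Ideal.mem_iInf] at hf
      have h1 := mem_span_gridProducts hVprime hspan (fun i j => coneIdeal_isPrime _) hVH hne
        (fun i j e f h => mem_coneIdeal_pow_of_linear_mul_mem (hW _ _) (hV j).1 (hV j).2.1 h)
        (fun i j j' e f hjj' h => mem_coneIdeal_pow_of_mul_mem (hW _ _) (hneV i j j' hjj') h)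
        (fun i => m i.rev + ns - 1) (fun j => ns - n j.rev) (f := f) (fun i j => by
          have := hf (i.rev, j.rev)
          simp only [Fin.rev_rev] at this
          rwa [hexp])
      refine (Ideal.span_le.2 ?_ : _ ≤ _) h1
      rintro _ ⟨t, rfl⟩
      have hpos : 0 < mr + ns := by
        have := hm ⟨r - 1, Nat.sub_one_lt_of_lt hr⟩
        omega
      -- Past `mr + ns - 1` all exponents of the `H i` are zero and those of the `V j` only grow, so
      -- larger `t` give multiples of the last product.
      let k : Fin (mr + ns) := ⟨min t (mr + ns - 1), by omega⟩
      refine Ideal.mem_of_dvd _ ?_ (Ideal.subset_span ⟨k, rfl⟩)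
      rw [hg, hgk]
      refine mul_dvd_mul (Finset.prod_dvd_prod_of_dvd _ _ fun i _ => pow_dvd_pow _ ?_)
        (Finset.prod_dvd_prod_of_dvd _ _ fun j _ => pow_dvd_pow _ ?_)
      · have := hmle i.rev
        simp only [k]
        omega
      · simp only [k]
        omega
  have hindep : ∀ k, g k ∉ Ideal.span (g '' {l | l ≠ k}) := by
    intro k
    -- Because indices are reversed, the index `0` carries the largest multiplicities, so here the
    -- exponents are exactly `mr + ns - 1 - l` and `l`.
    let i₀ : Fin r := ⟨0, hr⟩
    let j₀ : Fin s := ⟨0, hs⟩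
    have hi₀ : m i₀.rev = mr := by
      rw [hmr]; congr 1
    have hj₀ : n j₀.rev = ns := by
      rw [hns]; congr 1
    have hsplit : ∀ l, g l = H i₀ ^ (mr + ns - 1 - l) * V j₀ ^ (l : ℕ) *
        ((∏ i ∈ Finset.univ.erase i₀, H i ^ (m i.rev + ns - 1 - l)) *
          ∏ j ∈ Finset.univ.erase j₀, V j ^ (l - (ns - n j.rev))) := by
      intro l
      rw [hg, hgk, ← Finset.mul_prod_erase _ _ (Finset.mem_univ i₀),
        ← Finset.mul_prod_erase _ _ (Finset.mem_univ j₀), hi₀, hj₀, Nat.sub_self, Nat.sub_zero]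
      ring
    rw [hsplit]
    have hIp : (I i₀ j₀).IsPrime := coneIdeal_isPrime _
    refine notMem_span_of_exponents (hVprime j₀) (hVH i₀ j₀) (hHI i₀ j₀) (hVI i₀ j₀)
      (by omega) ?_ ?_
    -- The cofactor consists of powers of grid lines missing this point.
    · rw [hIp.mul_mem_iff_mem_or_mem, hIp.prod_mem_iff, hIp.prod_mem_iff]
      rintro (⟨i, hi, h⟩ | ⟨j, hj, h⟩)
      · exact hne i i₀ j₀ (Finset.ne_of_mem_erase hi) (hIp.mem_of_pow_mem _ h)
      · exact hneV i₀ j j₀ (Finset.ne_of_mem_erase hj) (hIp.mem_of_pow_mem _ h)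
    · rintro _ ⟨l, hl, rfl⟩
      refine ⟨l, by omega, fun h => hl (Fin.ext h), ?_⟩
      rw [hsplit]
      exact dvd_mul_right _ _
  refine ⟨injective_of_notMem_span hindep, fun _ => ?_,
    isMinimalGeneratingSet_range hgen hindep⟩
  rw [idealMul_fatIdeal hP hQ hm hn]
  exact isMinimalGeneratingSet_range hgen hindep
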